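/- Let $X$ be a locally finite $\mathrm{CAT}(0)$ cube complex with vertex set $X^{(0)}$, and let $\mathrm{Aut}(X)$ be its group of cubical automorphisms with the compact-open topology. Let $\mathrm{Aut}^{+}(X)$ be the subgroup of $\mathrm{Aut}(X)$ generated by all elements that fix some halfspace of $X$ pointwise, with the subspace topology. Let $\Sigma_0$ be a finite set with a fixpoint free involution $s \mapsto s^{-1}$. An admissible edge labeling is a map $\ell$ from the oriented edges of $X$ to $\Sigma_0$ such that: (A1) parallel oriented edges have the same label, and reversing the orientation of an edge inverts its label; (A2) distinct oriented edges with the same initial vertex have distinct labels; (A3) if $e_1, e_2$ are oriented edges with initial vertex $v$ and $e_1', e_2'$ are oriented edges with initial vertex $w$ such that $\ell(e_1) = \ell(e_1')$ and $\ell(e_2) = \ell(e_2')$, then $e_1, e_2$ span a square if and only if $e_1', e_2'$ span a square. Here two edges span a square if they have exactly one endpoint in common and the hyperplanes they cross are distinct and intersect. Two labels $s, t \in \Sigma_0$ commute, written $[s,t] = 1$, if there are oriented edges with a common initial vertex and labels $s$ and $t$ that span a square. Let $\Gamma$ be a group acting on $X$ by cubical automorphisms, transitively on $X^{(0)}$,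 and let $\ell$ be an admissible edge labeling of $X$ that is $\Gamma$-invariant, i.e. $\ell(g e) = \ell(e)$ for all $g \in \Gamma$ and all oriented edges $e$. Suppose there is some $s \in \Sigma_0$ which is the label of at least one oriented edge, such that for any two distinct $t, r \in \Sigma_0$ with $[s,t] = [s,r] = 1$ we have $t = r^{-1}$ or $[t,r] = 1$. Then $\mathrm{Aut}^{+}(X)$ is locally compact. Moreover, there is a finite set $K \subset X^{(0)}$ such that every element of $\mathrm{Aut}(X)$ that fixes every vertex in $K$ lies in $\mathrm{Aut}^{+}(X)$. -/

import Mathlib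

/-!
# Cube complexes, their automorphism groups, and admissible edge labelings

A cube complex is encoded by its vertex set `V` together with the collection of the vertex sets
of its cubes. Every cube is embedded, and two cubes meet in a common face or not at all; every
CAT(0) cube complex is of this kind.
-/

/-- `φ` identifies the vertex set of the standard cube `[0,1]^n` with `C`, and the members of
`cubes` which are contained in `C` are exactly the images of the (nonempty) faces of the standard
cube. A face is a product of nonempty subsets of `{0,1}`. -/
structure IsCubeChart {V : Type*} (cubes : Set (Set V)) (C : Set V) {n : ℕ}
    (φ : (Fin n → Bool) → V) : Prop where
  injective : Function.Injective φ
  range_eq : Set.range φ = C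
  mem_iff_face : ∀ D : Set V, D ⊆ C →
    (D ∈ cubes ↔ ∃ A : Fin n → Set Bool, (∀ i, (A i).Nonempty) ∧ D = φ '' Set.univ.pi A)

/-- A cube complex with vertex set `V`. The elements of `cubes` are the vertex sets of cubes. -/
structure CubeComplex (V : Type*) where
  cubes : Set (Set V)
  singleton_mem : ∀ v : V, {v} ∈ cubes
  exists_chart : ∀ C ∈ cubes, ∃ (n : ℕ) (φ : (Fin n → Bool) → V), IsCubeChart cubes C φ
  inter_mem : ∀ C ∈ cubes, ∀ D ∈ cubes, (C ∩ D).Nonempty → C ∩ D ∈ cubes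

namespace CubeComplex

variable {V : Type*} (X : CubeComplex V)

/-- Every vertex lies in only finitely many cubes. -/
def LocallyFinite : Prop := ∀ v : V, {C | C ∈ X.cubes ∧ v ∈ C}.Finite

/-! ### Geometric realization -/

/-- The point with coordinates `x ∈ [0,1]^n` in the cube parametrized by `φ`, encoded by its
multilinear barycentric coordinates: the weight of the vertex `φ b` is the product over `i` of
`x i` (if `b i = 1`) and `1 - x i` (if `b i = 0`), and vertices outside of the cube have
weight zero. -/
noncomputable def cubePoint {n : ℕ} (φ : (Fin n → Bool) → V) (x : Fin n → ℝ) : V → ℝ :=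
  Function.extend φ (fun b => ∏ i, if b i then x i else 1 - x i) 0

/-- The geometric realization of `X`: the union of all its (solid) cubes. -/
def Realization : Type _ :=
  {p : V → ℝ // ∃ (n : ℕ) (φ : (Fin n → Bool) → V) (x : Fin n → ℝ),
    (∃ C ∈ X.cubes, IsCubeChart X.cubes C φ) ∧ (∀ i, x i ∈ Set.Icc (0 : ℝ) 1) ∧
      p = cubePoint φ x}

/-- The topology of convergence of all barycentric coordinates. On each cube it is the Euclidean
topology, and if `X` is locally finite, then it is the usual (weak, or equivalently metric)
topology on the realization. -/
instance : TopologicalSpace X.Realization :=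
  inferInstanceAs (TopologicalSpace {p : V → ℝ // ∃ (n : ℕ) (φ : (Fin n → Bool) → V)
    (x : Fin n → ℝ), (∃ C ∈ X.cubes, IsCubeChart X.cubes C φ) ∧
      (∀ i, x i ∈ Set.Icc (0 : ℝ) 1) ∧ p = cubePoint φ x})

/-! ### Nonpositive curvature -/

/-- The `1`-skeleton of `X`. -/
def skeleton : SimpleGraph V where
  Adj v w := v ≠ w ∧ {v, w} ∈ X.cubes
  symm := ⟨fun v w h => ⟨h.1.symm, by rw [Set.pair_comm]; exact h.2⟩⟩
  loopless := ⟨fun _ h => h.1 rfl⟩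

/-- The link of every vertex `v` is a flag simplicial complex: if `N` is a finite set of neighbours
of `v` such that the edges from `v` to any two of them lie in a common cube, then the edges from
`v` to all elements of `N` lie in a common cube. -/
def FlagLinks : Prop :=
  ∀ (v : V) (N : Set V), N.Finite → (∀ a ∈ N, X.skeleton.Adj v a) →
    (∀ a ∈ N, ∀ b ∈ N, ∃ C ∈ X.cubes, v ∈ C ∧ a ∈ C ∧ b ∈ C) →
      ∃ C ∈ X.cubes, v ∈ C ∧ N ⊆ C

/-- A (locally finite) cube complex is CAT(0) if it is simply connected and all its vertex links
are flag complexes. -/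
structure IsCAT0 : Prop where
  simplyConnected : SimplyConnectedSpace X.Realization
  flagLinks : X.FlagLinks

/-! ### Oriented edges, hyperplanes and halfspaces -/

/-- Oriented edges. The edge `e` goes from `e.fst` to `e.snd`, and `e.symm` is the same geometric
edge with the opposite orientation. -/
abbrev OEdge : Type _ := X.skeleton.Dart

/-- `a, b, c, d` are the vertices of a square of `X`, in cyclic order. -/
def IsSquare (a b c d : V) : Prop :=
  X.skeleton.Adj a b ∧ X.skeleton.Adj b c ∧ X.skeleton.Adj c d ∧ X.skeleton.Adj d a ∧
    a ≠ c ∧ b ≠ d ∧ {a, b, c, d} ∈ X.cubes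

variable {X} in
/-- Parallelism of oriented edges: the equivalence relation generated by identifying opposite,
equally oriented edges of squares. -/
def Parallel : X.OEdge → X.OEdge → Prop :=
  Relation.EqvGen fun e f => X.IsSquare e.fst e.snd f.snd f.fst

variable {X} in
/-- The oriented edges `e` and `f` cross the same hyperplane. -/
def SameHyperplane (e f : X.OEdge) : Prop := Parallel e f ∨ Parallel e f.symm

variable {X} in
/-- The hyperplanes crossed by `e` and `e'` intersect transversally: they are distinct and there
is a square with a corner at which one edge crosses the first hyperplane and the other edge
crosses the second one. -/
def Transverse (e e' : X.OEdge) : Prop :=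
  ¬ SameHyperplane e e' ∧ ∃ f f' : X.OEdge, f.fst = f'.fst ∧
    (∃ w, X.IsSquare f.fst f.snd w f'.snd) ∧ SameHyperplane e f ∧ SameHyperplane e' f'

variable {X} in
/-- Two edges span a square if they have precisely one endpoint in common and the hyperplanes they
cross intersect transversally. -/
def SpanSquare (e e' : X.OEdge) : Prop :=
  (∃! v : V, v ∈ e.edge ∧ v ∈ e'.edge) ∧ Transverse e e'

variable {X} in
/-- The (vertex set of the) halfspace bounded by the hyperplane crossed by `e` that contains the
endpoint of `e`: all vertices that can be joined to `e.snd` by an edge path which does not cross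
this hyperplane. -/
def halfspace (e : X.OEdge) : Set V :=
  {v | Relation.ReflTransGen
    (fun a b => ∃ f : X.OEdge, f.fst = a ∧ f.snd = b ∧ ¬ SameHyperplane e f) e.snd v}

/-- `h` is a halfspace of `X`. -/
def IsHalfspace (h : Set V) : Prop := ∃ e : X.OEdge, h = halfspace e

/-! ### The automorphism group -/

/-- The permutations of the vertices that send cubes to cubes, as do their inverses. -/
def autGroup : Subgroup (Equiv.Perm V) where
  carrier := {g | ∀ C : Set V, g '' C ∈ X.cubes ↔ C ∈ X.cubes}
  one_mem' := by intro C; simp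
  mul_mem' := by
    intro g h hg hh C
    have : (⇑(g * h) : V → V) '' C = g '' (h '' C) := by
      rw [Set.image_image]; rfl
    rw [this, hg, hh]
  inv_mem' := by
    intro g hg C
    rw [← hg ((⇑g⁻¹ : V → V) '' C), Set.image_image]
    simp

/-- The group `Aut(X)` of automorphisms of `X`. -/
def Aut : Type _ := X.autGroup

instance : Group X.Aut := inferInstanceAs (Group X.autGroup)

instance : MulAction X.Aut V := inferInstanceAs (MulAction X.autGroup V)

variable {X}

theorem Aut.image_mem_iff (g : X.Aut) (C : Set V) :
    (fun v => g • v) '' C ∈ X.cubes ↔ C ∈ X.cubes := g.2 C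

theorem Aut.isCubeChart (g : X.Aut) {C : Set V} {n : ℕ} {φ : (Fin n → Bool) → V}
    (h : IsCubeChart X.cubes C φ) :
    IsCubeChart X.cubes ((fun v => g • v) '' C) (fun b => g • φ b) where
  injective := (MulAction.injective g).comp h.injective
  range_eq := by rw [← h.range_eq, ← Set.range_comp]; rfl
  mem_iff_face := by
    intro D hD
    obtain ⟨D, rfl⟩ : ∃ D', D = (fun v => g • v) '' D' :=
      ⟨(fun v => g • v) ⁻¹' D,
        (Set.image_preimage_eq D (MulAction.surjective g)).symm⟩
    have hD' : D ⊆ C := (Set.image_subset_image_iff (MulAction.injective g)).1 hD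
    rw [g.image_mem_iff, h.mem_iff_face D hD']
    refine exists_congr fun A => and_congr_right fun _ => ?_
    rw [show (fun b => g • φ b) '' Set.univ.pi A = (fun v => g • v) '' (φ '' Set.univ.pi A) by
      rw [Set.image_image], (MulAction.injective g).image_injective.eq_iff]

/-- The homeomorphism (here: continuous map) of the realization induced by an automorphism; it maps the point of the cube
`φ` with coordinates `x` to the point of the cube `g ∘ φ` with coordinates `x`. -/
def Aut.realize (g : X.Aut) : C(X.Realization, X.Realization) where
  toFun p := ⟨fun v => p.1 (g⁻¹ • v), by
    obtain ⟨p, n, φ, x, ⟨C, hC, hφ⟩, hx, rfl⟩ := p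
    refine ⟨n, fun b => g • φ b, x, ⟨_, (g.image_mem_iff C).2 hC, g.isCubeChart hφ⟩, hx, ?_⟩
    have hinj : Function.Injective fun b => g • φ b :=
      (MulAction.injective g).comp hφ.injective
    funext v
    obtain ⟨w, rfl⟩ := MulAction.surjective g v
    simp only [cubePoint, inv_smul_smul]
    by_cases hw : ∃ b, φ b = w
    · obtain ⟨b, rfl⟩ := hw
      rw [hφ.injective.extend_apply]
      exact (hinj.extend_apply (fun b => ∏ i, if b i = true then x i else 1 - x i) 0 b).symm
    · rw [Function.extend_apply' _ _ _ hw, Function.extend_apply' _ _ _ (by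
        rintro ⟨b, hb⟩
        exact hw ⟨b, MulAction.injective g hb⟩)]
      rfl⟩
  continuous_toFun := by
    refine Continuous.subtype_mk (continuous_pi fun v => ?_) _
    exact (continuous_apply (g⁻¹ • v)).comp continuous_subtype_val

/-- `Aut(X)` carries the compact-open topology, as a group of homeomorphisms of the realization. -/
instance : TopologicalSpace X.Aut :=
  TopologicalSpace.induced Aut.realize ContinuousMap.compactOpen

/-- The action of automorphisms on oriented edges. -/
def Aut.mapEdge (g : X.Aut) (e : X.OEdge) : X.OEdge where
  toProd := (g • e.fst, g • e.snd)
  adj := ⟨fun h => e.adj.1 (MulAction.injective g h), by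
    have := (g.image_mem_iff {e.fst, e.snd}).2 e.adj.2
    rwa [Set.image_pair] at this⟩

variable (X) in
/-- The subgroup of `Aut(X)` generated by all elements that fix some halfspace pointwise. -/
def AutPlus : Subgroup X.Aut :=
  Subgroup.closure {g | ∃ h : Set V, X.IsHalfspace h ∧ ∀ v ∈ h, g • v = v}

/-! ### Admissible edge labelings -/

/-- `ℓ` is an admissible edge labeling with values in a set `S` that carries an involution
`s ↦ s⁻¹`. -/
structure IsAdmissible {S : Type*} [InvolutiveInv S] (ℓ : X.OEdge → S) : Prop where
  parallel : ∀ e f, Parallel e f → ℓ e = ℓ f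
  symm : ∀ e : X.OEdge, ℓ e.symm = (ℓ e)⁻¹
  injective : ∀ e f : X.OEdge, e.fst = f.fst → ℓ e = ℓ f → e = f
  square : ∀ e₁ e₂ f₁ f₂ : X.OEdge, e₁.fst = e₂.fst → f₁.fst = f₂.fst →
    ℓ e₁ = ℓ f₁ → ℓ e₂ = ℓ f₂ → (SpanSquare e₁ e₂ ↔ SpanSquare f₁ f₂)

/-- The labels `s` and `t` commute: there are two edges with these labels that emanate from the
same vertex and span a square. -/
def LabelsCommute {S : Type*} (ℓ : X.OEdge → S) (s t : S) : Prop :=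
  ∃ e f : X.OEdge, e.fst = f.fst ∧ SpanSquare e f ∧ ℓ e = s ∧ ℓ f = t

end CubeComplex

/-! Let `s` be the label of an edge `e` at the vertex `v`. If an automorphism `g` fixes `v` and its
neighbours, then it also fixes the neighbours, in the carrier of the hyperplane `H` crossed by `e`,
of every vertex at which an edge with label `s` crosses `H`: passing from such a vertex to the next
one, along an edge whose label `t` commutes with `s`, the condition on `s` provides squares that
force `g` to fix every new edge but the one with label `t`, and that one is then fixed because `g`
permutes the edges of the carrier. Hence `g` fixes the carrier of `H`.

Since opposite edges of a square cross the same hyperplanes, the edges that cross `H` define a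
double cover of `X`. It is trivial because `X` is simply connected, i.e. `H` separates `X`. An
automorphism that fixes the carrier of `H` can therefore be cut along `H` into a product of two
automorphisms each of which fixes a side of `H` pointwise, so it lies in `Aut⁺(X)`.

Thus `K` can be taken to consist of `v` and its neighbours. In particular `Aut⁺(X)` is open in
`Aut(X)`, and `Aut(X)` is locally compact because the sets `{g | g v = w}` are compact and open. -/

theorem eq_of_joined_of_isCoveringMap {E B : Type*} [TopologicalSpace E] [TopologicalSpace B]
    [SimplyConnectedSpace B] {p : E → B} (hp : IsCoveringMap p) {x y : E} (hjoined : Joined x y)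
    (hxy : p x = p y) : x = y := by
  obtain ⟨γ⟩ := hjoined
  have hmonodromy : hp.monodromy (.refl (p x)) ⟨x, rfl⟩ = ⟨y, hxy.symm⟩ :=
    hp.monodromy_eq_of_map_eq (.mk γ) (Subsingleton.elim _ _)
  rw [hp.monodromy_refl] at hmonodromy
  exact congrArg Subtype.val hmonodromy

namespace CubeComplex

variable {V : Type*} {X : CubeComplex V}

section CubePoint

variable {n : ℕ} {φ : (Fin n → Bool) → V}

theorem cubePoint_apply (hφ : Function.Injective φ) (x : Fin n → ℝ) (b : Fin n → Bool) :
    cubePoint φ x (φ b) = ∏ i, if b i then x i else 1 - x i :=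
  hφ.extend_apply _ _ _

theorem cubePoint_of_notMem_range (x : Fin n → ℝ) {v : V} (hv : v ∉ Set.range φ) :
    cubePoint φ x v = 0 :=
  Function.extend_apply' _ _ _ hv

theorem continuous_cubePoint (hφ : Function.Injective φ) : Continuous (cubePoint φ) := by
  refine continuous_pi fun v => ?_
  by_cases hv : v ∈ Set.range φ
  · obtain ⟨b, rfl⟩ := hv
    simp only [cubePoint_apply hφ]
    refine continuous_finsetProd _ fun i _ => ?_
    split_ifs <;> fun_prop
  · simp only [cubePoint_of_notMem_range _ hv]
    exact continuous_const

open Classical in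
theorem cubePoint_indicator (hφ : Function.Injective φ) (b : Fin n → Bool) (v : V) :
    cubePoint φ (fun i => if b i then 1 else 0) v = if v = φ b then 1 else 0 := by
  by_cases hv : v ∈ Set.range φ
  · obtain ⟨c, rfl⟩ := hv
    rw [cubePoint_apply hφ]
    split_ifs with h
    · rw [hφ h]
      exact Finset.prod_eq_one fun i _ => by cases b i <;> simp
    · obtain ⟨i, hi⟩ : ∃ i, c i ≠ b i := Function.ne_iff.1 fun hcb => h (congrArg φ hcb)
      refine Finset.prod_eq_zero (Finset.mem_univ i) ?_
      cases hb : b i <;> cases hc : c i <;> simp_all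
  · rw [cubePoint_of_notMem_range _ hv, if_neg]
    rintro rfl
    exact hv ⟨b, rfl⟩

end CubePoint

namespace Realization

theorem continuous_coord (v : V) : Continuous fun p : X.Realization => p.1 v :=
  (continuous_apply v).comp continuous_subtype_val

theorem coord_nonneg (p : X.Realization) (v : V) : 0 ≤ p.1 v := by
  obtain ⟨p, n, φ, x, ⟨C, hC, hφ⟩, hx, rfl⟩ := p
  by_cases hv : v ∈ Set.range φ
  · obtain ⟨b, rfl⟩ := hv
    simp only [cubePoint_apply hφ.injective]
    refine Finset.prod_nonneg fun i _ => ?_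
    split_ifs
    · exact (hx i).1
    · exact sub_nonneg.2 (hx i).2
  · exact (cubePoint_of_notMem_range _ hv).ge

theorem exists_support_subset (p : X.Realization) :
    ∃ C ∈ X.cubes, Function.support p.1 ⊆ C := by
  obtain ⟨p, n, φ, x, ⟨C, hC, hφ⟩, hx, rfl⟩ := p
  refine ⟨C, hC, fun v hv => ?_⟩
  rw [← hφ.range_eq]
  exact not_not.1 fun h => hv (cubePoint_of_notMem_range x h)

variable (X) in
/-- The points of the realization with positive weight at the vertex `v`, that is, the union of the
open cubes whose closure contains `v`. -/
def openStar (v : V) : Set X.Realization := {p | 0 < p.1 v}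

theorem isOpen_openStar (v : V) : IsOpen (openStar X v) :=
  isOpen_lt continuous_const (continuous_coord v)

theorem exists_mem_openStar (p : X.Realization) : ∃ v, p ∈ openStar X v := by
  obtain ⟨p, n, φ, x, ⟨C, hC, hφ⟩, hx, rfl⟩ := p
  refine ⟨φ fun i => decide (0 < x i), ?_⟩
  change 0 < cubePoint φ x _
  rw [cubePoint_apply hφ.injective]
  refine Finset.prod_pos fun i _ => ?_
  by_cases h : 0 < x i
  · simp [h]
  · simp [le_antisymm (not_lt.1 h) (hx i).1]

theorem exists_cube_of_mem_openStar {p : X.Realization} {v : V} (hp : p ∈ openStar X v) :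
    ∃ C ∈ X.cubes, v ∈ C ∧ Function.support p.1 ⊆ C := by
  obtain ⟨C, hC, hsupp⟩ := p.exists_support_subset
  exact ⟨C, hC, hsupp (ne_of_gt hp), hsupp⟩

open Classical in
variable (X) in
/-- The vertex `v`, as a point of the realization. -/
noncomputable def vertex (v : V) : X.Realization :=
  ⟨fun w => if w = v then 1 else 0, by
    obtain ⟨n, φ, hφ⟩ := X.exists_chart _ (X.singleton_mem v)
    obtain ⟨b, rfl⟩ : v ∈ Set.range φ := hφ.range_eq ▸ Set.mem_singleton v
    refine ⟨n, φ, fun i => if b i then 1 else 0, ⟨_, X.singleton_mem _, hφ⟩, fun i => ?_,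
      funext fun w => (cubePoint_indicator hφ.injective b w).symm⟩
    by_cases h : b i <;> simp [h]⟩

@[simp]
theorem vertex_apply_self (v : V) : (vertex X v).1 v = 1 := if_pos rfl

theorem vertex_apply_of_ne {v w : V} (h : w ≠ v) : (vertex X v).1 w = 0 := if_neg h

theorem support_vertex_subset {v : V} {C : Set V} (hv : v ∈ C) :
    Function.support (vertex X v).1 ⊆ C := by
  intro w hw
  by_cases h : w = v
  · exact h ▸ hv
  · exact absurd (vertex_apply_of_ne h) hw

theorem exists_path_in_cube {C : Set V} (hC : C ∈ X.cubes) {v w : V} (hv : v ∈ C) (hw : w ∈ C) :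
    ∃ γ : Path (vertex X v) (vertex X w), ∀ t, Function.support (γ t).1 ⊆ C := by
  obtain ⟨n, φ, hφ⟩ := X.exists_chart C hC
  rw [← hφ.range_eq] at hv hw
  obtain ⟨b, rfl⟩ := hv
  obtain ⟨c, rfl⟩ := hw
  let corner (d : Fin n → Bool) : Fin n → ℝ := fun i => if d i then 1 else 0
  have hcorner (d : Fin n → Bool) : corner d ∈ Set.Icc (0 : Fin n → ℝ) 1 :=
    ⟨fun i => by cases h : d i <;> simp [corner, h], fun i => by cases h : d i <;> simp [corner, h]⟩
  let x (t : unitInterval) : Fin n → ℝ := AffineMap.lineMap (corner b) (corner c) (t : ℝ)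
  have hx (t : unitInterval) : x t ∈ Set.Icc (0 : Fin n → ℝ) 1 :=
    (convex_Icc _ _).lineMap_mem (hcorner b) (hcorner c) t.2
  let p (t : unitInterval) : X.Realization :=
    ⟨cubePoint φ (x t), n, φ, x t, ⟨C, hC, hφ⟩, fun i => ⟨(hx t).1 i, (hx t).2 i⟩, rfl⟩
  have hvertex (d : Fin n → Bool) : cubePoint φ (corner d) = (vertex X (φ d)).1 :=
    funext fun v => cubePoint_indicator hφ.injective d v
  refine ⟨⟨⟨p, ?_⟩, Subtype.ext ?_, Subtype.ext ?_⟩, fun t v hv => ?_⟩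
  · exact ((continuous_cubePoint hφ.injective).comp (by fun_prop)).subtype_mk _
  · simp [p, x, hvertex]
  · simp [p, x, hvertex]
  · rw [← hφ.range_eq]
    exact not_not.1 fun h => hv (cubePoint_of_notMem_range (x t) h)

end Realization

/-! ### Double covers defined by sign cocycles -/

variable (X) in
/-- The signs `σ v w`, for vertices `v`, `w` of a common cube, satisfy the cocycle condition on
every cube; the other values of `σ` are irrelevant. -/
def IsSignCocycle (σ : V → V → ℤˣ) : Prop :=
  ∀ C ∈ X.cubes, ∀ u ∈ C, ∀ v ∈ C, ∀ w ∈ C, σ u v * σ v w = σ u w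

theorem IsSignCocycle.apply_self {σ : V → V → ℤˣ} (hσ : X.IsSignCocycle σ) (v : V) :
    σ v v = 1 :=
  mul_eq_left.1 (hσ _ (X.singleton_mem v) v rfl v rfl v rfl)

theorem abs_units_smul (ε : ℤˣ) (r : ℝ) : |ε • r| = |r| := by
  rcases Int.units_eq_one_or ε with rfl | rfl <;> simp [Units.smul_def]

/-- The sign of a nonzero real number; the value at `0` is irrelevant. -/
noncomputable def unitSign (r : ℝ) : ℤˣ := if 0 < r then 1 else -1

theorem unitSign_smul_abs (r : ℝ) : unitSign r • |r| = r := by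
  unfold unitSign
  split_ifs with h
  · simp [abs_of_pos h]
  · simp [Units.smul_def, abs_of_nonpos (not_lt.1 h)]

theorem unitSign_smul_of_pos (ε : ℤˣ) {r : ℝ} (hr : 0 < r) : unitSign (ε • r) = ε := by
  rcases Int.units_eq_one_or ε with rfl | rfl <;> simp [unitSign, Units.smul_def, hr, hr.le]

theorem continuousAt_unitSign {r : ℝ} (hr : r ≠ 0) : ContinuousAt unitSign r := by
  rcases lt_or_gt_of_ne hr with h | h
  · refine (continuousAt_const (y := (-1 : ℤˣ))).congr ?_
    filter_upwards [eventually_lt_nhds h] with s hs using (if_neg hs.not_gt).symm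
  · refine (continuousAt_const (y := (1 : ℤˣ))).congr ?_
    filter_upwards [eventually_gt_nhds h] with s hs using (if_pos hs).symm

variable (X) in
/-- The double cover of the realization whose sheets are glued according to `σ`: its points are
the points of the realization together with signed coordinates that are compatible with `σ`. -/
abbrev DoubleCover (σ : V → V → ℤˣ) : Type _ :=
  {q : X.Realization × (V → ℝ) // (∀ v, |q.2 v| = q.1.1 v) ∧
    ∀ v w, q.1.1 v * q.2 w = σ v w • (q.1.1 w * q.2 v)}

namespace DoubleCover

open Realization

variable {σ : V → V → ℤˣ}

/-- The covering map from the double cover to the realization. -/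
def proj (q : DoubleCover X σ) : X.Realization := q.1.1

theorem continuous_proj : Continuous (proj : DoubleCover X σ → X.Realization) :=
  continuous_fst.comp continuous_subtype_val

theorem continuous_signedCoord (v : V) : Continuous fun q : DoubleCover X σ => q.1.2 v :=
  (continuous_apply v).comp (continuous_snd.comp continuous_subtype_val)

/-- The lift of the point `p` of a cube with vertex `v` to the sheet over this cube on which the
`v`-coordinate has sign `ε`. -/
def lift (hσ : X.IsSignCocycle σ) (v : V) (ε : ℤˣ) (p : X.Realization)
    (hp : ∃ C ∈ X.cubes, v ∈ C ∧ Function.support p.1 ⊆ C) : DoubleCover X σ :=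
  ⟨(p, fun w => (ε * σ v w) • p.1 w),
    fun w => by rw [abs_units_smul, abs_of_nonneg (p.coord_nonneg w)], fun u w => by
      obtain ⟨C, hC, hv, hsupp⟩ := hp
      by_cases hu : p.1 u = 0
      · simp [hu]
      by_cases hw : p.1 w = 0
      · simp [hw]
      simp only [mul_smul_comm, smul_smul]
      rw [← hσ C hC v hv u (hsupp hu) w (hsupp hw), mul_comm (p.1 u)]
      congr 1
      ac_rfl⟩

theorem lift_unitSign (hσ : X.IsSignCocycle σ) {v : V} {q : DoubleCover X σ}
    (hq : q.proj ∈ openStar X v) :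
    lift hσ v (unitSign (q.1.2 v)) q.proj (exists_cube_of_mem_openStar hq) = q := by
  refine Subtype.ext (Prod.ext rfl (funext fun w => ?_))
  have hv : q.1.2 v = unitSign (q.1.2 v) • q.1.1.1 v := by
    rw [← q.2.1 v, unitSign_smul_abs]
  have hcompat : q.1.1.1 v * q.1.2 w = q.1.1.1 v * (unitSign (q.1.2 v) * σ v w) • q.1.1.1 w := by
    rw [q.2.2 v w]
    nth_rewrite 1 [hv]
    simp only [mul_smul_comm, smul_smul]
    rw [mul_comm (q.1.1.1 w), mul_comm (σ v w)]
  exact (mul_left_cancel₀ (ne_of_gt hq) hcompat).symm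

/-- The trivialization of the double cover over the open star of `v`, given by the sign of the
`v`-coordinate. -/
noncomputable def trivialization (hσ : X.IsSignCocycle σ) (v : V) :
    proj (σ := σ) ⁻¹' openStar X v ≃ₜ openStar X v × ℤˣ where
  toFun q := (⟨q.1.proj, q.2⟩, unitSign (q.1.1.2 v))
  invFun r := ⟨lift hσ v r.2 r.1.1 (exists_cube_of_mem_openStar r.1.2), r.1.2⟩
  left_inv q := Subtype.ext (lift_unitSign hσ q.2)
  right_inv r := by
    refine Prod.ext rfl ?_
    change unitSign ((r.2 * σ v v) • r.1.1.1 v) = r.2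
    rw [hσ.apply_self, mul_one, unitSign_smul_of_pos _ r.1.2]
  continuous_toFun := by
    refine ((continuous_proj.comp continuous_subtype_val).subtype_mk _).prodMk ?_
    refine continuous_iff_continuousAt.2 fun q => ContinuousAt.comp (continuousAt_unitSign ?_)
      ((continuous_signedCoord v).comp continuous_subtype_val).continuousAt
    exact abs_pos.1 ((q.1.2.1 v).symm ▸ q.2)
  continuous_invFun := by
    have hp : Continuous fun r : openStar X v × ℤˣ => r.1.1 :=
      continuous_subtype_val.comp continuous_fst
    refine ((hp.prodMk (continuous_pi fun w => ?_)).subtype_mk _).subtype_mk _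
    have hsign : Continuous fun ε : ℤˣ => (((ε * σ v w : ℤˣ) : ℤ) : ℝ) :=
      continuous_of_discreteTopology
    simp only [Units.smul_def, zsmul_eq_mul]
    exact (hsign.comp continuous_snd).mul ((continuous_coord w).comp hp)

theorem isCoveringMap_proj (hσ : X.IsSignCocycle σ) :
    IsCoveringMap (proj : DoubleCover X σ → X.Realization) := by
  intro p
  obtain ⟨v, hv⟩ := p.exists_mem_openStar
  exact IsEvenlyCovered.to_isEvenlyCovered_preimage (I := ℤˣ) ⟨inferInstance, openStar X v, hv,
    isOpen_openStar v, (isOpen_openStar v).preimage continuous_proj, trivialization hσ v,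
    fun _ => rfl⟩

/-- The lift of the vertex `v` with sign `ε`. -/
noncomputable def vertexLift (hσ : X.IsSignCocycle σ) (v : V) (ε : ℤˣ) : DoubleCover X σ :=
  lift hσ v ε (vertex X v) ⟨{v}, X.singleton_mem v, rfl, support_vertex_subset rfl⟩

theorem vertexLift_injective (hσ : X.IsSignCocycle σ) (v : V) :
    Function.Injective (vertexLift hσ v) := by
  intro ε δ h
  have hv : (ε * σ v v) • (vertex X v).1 v = (δ * σ v v) • (vertex X v).1 v :=
    congrArg (fun q : DoubleCover X σ => q.1.2 v) h
  rw [vertex_apply_self, hσ.apply_self, mul_one, mul_one] at hv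
  simpa [Units.smul_def, Units.ext_iff] using hv

theorem joined_vertexLift (hσ : X.IsSignCocycle σ) {C : Set V} (hC : C ∈ X.cubes) {v w : V}
    (hv : v ∈ C) (hw : w ∈ C) (ε : ℤˣ) :
    Joined (vertexLift hσ v ε) (vertexLift hσ w (ε * σ v w)) := by
  obtain ⟨γ, hγ⟩ := exists_path_in_cube hC hv hw
  have hcont : Continuous fun t => lift hσ v ε (γ t) ⟨C, hC, hv, hγ t⟩ := by
    refine (γ.continuous.prodMk (continuous_pi fun u => ?_)).subtype_mk _
    simp only [Units.smul_def, zsmul_eq_mul]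
    exact continuous_const.mul ((continuous_coord u).comp γ.continuous)
  refine ⟨⟨⟨_, hcont⟩, ?_, ?_⟩⟩
  · simp only [γ.source, vertexLift]
  · refine Subtype.ext (Prod.ext γ.target (funext fun u => ?_))
    change (ε * σ v u) • (γ 1).1 u = (ε * σ v w * σ w u) • (vertex X w).1 u
    rw [γ.target]
    by_cases hu : u = w
    · rw [hu, hσ.apply_self, mul_one]
    · rw [vertex_apply_of_ne hu, smul_zero, smul_zero]

end DoubleCover

theorem OEdge.ext {e f : X.OEdge} (hfst : e.fst = f.fst) (hsnd : e.snd = f.snd) : e = f :=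
  SimpleGraph.Dart.ext e f (Prod.ext hfst hsnd)

/-! ### Faces of the standard cube -/

section StandardCube

variable {ι : Type*}

/-- The vertices of the face of the standard cube that contains `b` and whose directions are the
elements of `I`. -/
def face (I : Set ι) (b : ι → Bool) : Set (ι → Bool) := {d | ∀ k ∉ I, d k = b k}

theorem face_empty (b : ι → Bool) : face ∅ b = {b} := by
  ext d
  simp [face, funext_iff]

variable [DecidableEq ι]

/-- The vertex of the standard cube that differs from `b` precisely in the coordinate `i`. -/
def flipAt (i : ι) (b : ι → Bool) : ι → Bool := Function.update b i (!b i)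

@[simp]
theorem flipAt_self (i : ι) (b : ι → Bool) : flipAt i b i = !b i := Function.update_self _ _ _

theorem flipAt_of_ne {i k : ι} (h : k ≠ i) (b : ι → Bool) : flipAt i b k = b k :=
  Function.update_of_ne h _ _

theorem flipAt_flipAt (i : ι) (b : ι → Bool) : flipAt i (flipAt i b) = b := by
  simp [flipAt]

theorem flipAt_comm {i j : ι} (h : i ≠ j) (b : ι → Bool) :
    flipAt i (flipAt j b) = flipAt j (flipAt i b) := by
  simp only [flipAt, Function.update_of_ne h, Function.update_of_ne h.symm]
  exact Function.update_comm h.symm _ _ _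

theorem flipAt_ne (i : ι) (b : ι → Bool) : flipAt i b ≠ b := fun h => by
  simpa using congrFun h i

theorem update_eq_or_eq_flipAt (b : ι → Bool) (i : ι) (x : Bool) :
    Function.update b i x = b ∨ Function.update b i x = flipAt i b := by
  by_cases hx : x = b i
  · exact .inl (hx ▸ Function.update_eq_self i b)
  · exact .inr (congrArg _ (Bool.eq_not.2 hx))

theorem flipAt_induction [Finite ι] {P : (ι → Bool) → Prop}
    (h : ∀ b i, P b → P (flipAt i b)) {b : ι → Bool} (hb : P b) (c : ι → Bool) : P c := by
  obtain ⟨_⟩ := nonempty_fintype ι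
  have hpiecewise (s : Finset ι) : P (s.piecewise c b) := by
    induction s using Finset.induction_on with
    | empty => simpa using hb
    | insert i s _ ih =>
      rw [Finset.piecewise_insert]
      rcases update_eq_or_eq_flipAt (s.piecewise c b) i (c i) with hi | hi <;> rw [hi]
      exacts [ih, h _ i ih]
  simpa using hpiecewise Finset.univ

theorem face_insert (i : ι) (I : Set ι) (b : ι → Bool) :
    face (insert i I) b = face I b ∪ face I (flipAt i b) := by
  ext d
  refine ⟨fun hd => ?_, fun hd k hk => ?_⟩
  · have heq : ∀ k ≠ i, k ∉ I → d k = b k := fun k hki hkI => hd k (by simp [hki, hkI])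
    by_cases hi : d i = b i
    · refine .inl fun k hk => ?_
      by_cases hki : k = i
      exacts [hki ▸ hi, heq k hki hk]
    · refine .inr fun k hk => ?_
      by_cases hki : k = i
      · rw [hki, flipAt_self, Bool.eq_not.2 hi]
      · rw [flipAt_of_ne hki, heq k hki hk]
  · rw [Set.mem_insert_iff, not_or] at hk
    rcases hd with hd | hd
    · exact hd k hk.2
    · rw [hd k hk.2, flipAt_of_ne hk.1]

theorem face_singleton (i : ι) (b : ι → Bool) : face {i} b = {b, flipAt i b} := by
  rw [← insert_empty_eq, face_insert, face_empty, face_empty, Set.singleton_union]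

end StandardCube

end CubeComplex

namespace IsCubeChart

open CubeComplex

variable {V : Type*}

theorem image_face_mem {cubes : Set (Set V)} {C : Set V} {n : ℕ} {φ : (Fin n → Bool) → V}
    (hφ : IsCubeChart cubes C φ) (I : Set (Fin n)) (b : Fin n → Bool) :
    φ '' face I b ∈ cubes := by
  refine (hφ.mem_iff_face _ (hφ.range_eq ▸ Set.image_subset_range φ _)).2
    ⟨fun k => {x | k ∉ I → x = b k}, fun k => ⟨b k, fun _ => rfl⟩, ?_⟩
  congr 1
  ext d
  simp [face]

variable {X : CubeComplex V} {C : Set V} {n : ℕ} {φ : (Fin n → Bool) → V}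

theorem apply_mem (hφ : IsCubeChart X.cubes C φ) (b : Fin n → Bool) : φ b ∈ C :=
  hφ.range_eq ▸ Set.mem_range_self b

theorem adj (hφ : IsCubeChart X.cubes C φ) (b : Fin n → Bool) (i : Fin n) :
    X.skeleton.Adj (φ b) (φ (flipAt i b)) := by
  refine ⟨fun h => flipAt_ne i b (hφ.injective h).symm, ?_⟩
  simpa only [face_singleton, Set.image_pair] using hφ.image_face_mem {i} b

/-- The oriented edge of a cube that starts at the vertex `b` of its chart, in direction `i`. -/
def edge (hφ : IsCubeChart X.cubes C φ) (b : Fin n → Bool) (i : Fin n) : X.OEdge :=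
  ⟨(φ b, φ (flipAt i b)), hφ.adj b i⟩

theorem edge_flipAt_self (hφ : IsCubeChart X.cubes C φ) (b : Fin n → Bool) (i : Fin n) :
    hφ.edge (flipAt i b) i = (hφ.edge b i).symm :=
  OEdge.ext rfl (congrArg φ (flipAt_flipAt i b))

theorem isSquare_edge (hφ : IsCubeChart X.cubes C φ) (b : Fin n → Bool) {i j : Fin n}
    (hij : i ≠ j) :
    X.IsSquare (hφ.edge b i).fst (hφ.edge b i).snd
      (hφ.edge (flipAt j b) i).snd (hφ.edge (flipAt j b) i).fst := by
  refine ⟨hφ.adj b i, ?_, (hφ.adj _ i).symm, (hφ.adj b j).symm, fun h => ?_, fun h => ?_, ?_⟩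
  · simpa only [edge, flipAt_comm hij] using hφ.adj (flipAt i b) j
  · have hi := congrFun (hφ.injective h) i
    simp [flipAt_of_ne hij] at hi
  · have hi := congrFun (hφ.injective h) i
    simp [flipAt_of_ne hij] at hi
  · have hface := hφ.image_face_mem {j, i} b
    rwa [face_insert, face_singleton, face_singleton, Set.image_union, Set.image_pair,
      Set.image_pair, Set.insert_union, Set.singleton_union,
      Set.pair_comm (φ (flipAt j b))] at hface

theorem exists_eq_flipAt_of_adj (hφ : IsCubeChart X.cubes C φ) {b c : Fin n → Bool}
    (h : X.skeleton.Adj (φ b) (φ c)) : ∃ i, c = flipAt i b := by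
  obtain ⟨i, hi⟩ := Function.ne_iff.1 fun hcb : c = b => h.1 (congrArg φ hcb.symm)
  obtain ⟨A, -, hA⟩ := (hφ.mem_iff_face {φ b, φ c}
    (Set.pair_subset (hφ.apply_mem b) (hφ.apply_mem c))).1 h.2
  rw [← Set.image_pair] at hA
  have hpair : {b, c} = Set.univ.pi A := hφ.injective.image_injective hA
  have hb : b ∈ Set.univ.pi A := hpair ▸ Set.mem_insert b {c}
  have hc : c ∈ Set.univ.pi A := hpair ▸ Set.mem_insert_of_mem b rfl
  have hflip : flipAt i b ∈ Set.univ.pi A := by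
    intro k _
    by_cases hk : k = i
    · rw [hk, flipAt_self, ← Bool.eq_not.2 hi]
      exact hc i trivial
    · rw [flipAt_of_ne hk]
      exact hb k trivial
  rw [← hpair] at hflip
  exact ⟨i, (hflip.resolve_left (flipAt_ne i b)).symm⟩

theorem exists_eq_edge (hφ : IsCubeChart X.cubes C φ) {f : X.OEdge} (hfst : f.fst ∈ C)
    (hsnd : f.snd ∈ C) : ∃ b i, f = hφ.edge b i := by
  rw [← hφ.range_eq] at hfst hsnd
  obtain ⟨b, hb⟩ := hfst
  obtain ⟨c, hc⟩ := hsnd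
  obtain ⟨i, rfl⟩ := hφ.exists_eq_flipAt_of_adj (hb ▸ hc ▸ f.adj)
  exact ⟨b, i, OEdge.ext hb.symm hc.symm⟩

end IsCubeChart

namespace CubeComplex

variable {V : Type*} {X : CubeComplex V}

theorem cube_induction {C : Set V} (hC : C ∈ X.cubes) {P : V → Prop}
    (h : ∀ e : X.OEdge, e.fst ∈ C → e.snd ∈ C → P e.fst → P e.snd) {v w : V} (hv : v ∈ C)
    (hw : w ∈ C) (hP : P v) : P w := by
  obtain ⟨n, φ, hφ⟩ := X.exists_chart C hC
  rw [← hφ.range_eq] at hv hw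
  obtain ⟨b, rfl⟩ := hv
  obtain ⟨c, rfl⟩ := hw
  exact flipAt_induction (P := fun d => P (φ d))
    (fun b i => h (hφ.edge b i) (hφ.apply_mem b) (hφ.apply_mem _)) hP c

/-- The union of the open stars of the vertices satisfying `P` is clopen, since a point of a cube
lies only in open stars of vertices of this cube. -/
theorem vertex_induction [PreconnectedSpace X.Realization] {P : V → Prop}
    (h : ∀ e : X.OEdge, P e.fst → P e.snd) {v : V} (hP : P v) (w : V) : P w := by
  let U (Q : V → Prop) : Set X.Realization := ⋃ v ∈ {v | Q v}, Realization.openStar X v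
  have mem_U {Q : V → Prop} {p : X.Realization} :
      p ∈ U Q ↔ ∃ v, Q v ∧ p ∈ Realization.openStar X v := by simp [U]
  have isOpen_U (Q : V → Prop) : IsOpen (U Q) :=
    isOpen_biUnion fun v _ => Realization.isOpen_openStar v
  have hcompl : (U P)ᶜ = U fun v => ¬ P v := by
    ext p
    rw [Set.mem_compl_iff, mem_U, mem_U]
    constructor
    · intro hp
      obtain ⟨u, hu⟩ := p.exists_mem_openStar
      exact ⟨u, fun hPu => hp ⟨u, hPu, hu⟩, hu⟩
    · rintro ⟨u, hu, hpu⟩ ⟨u', hu', hpu'⟩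
      obtain ⟨C, hC, hsupp⟩ := p.exists_support_subset
      exact hu (cube_induction hC (fun e _ _ => h e) (hsupp (ne_of_gt hpu'))
        (hsupp (ne_of_gt hpu)) hu')
  have hclopen : IsClopen (U P) := ⟨⟨hcompl ▸ isOpen_U _⟩, isOpen_U _⟩
  have hvertex (u : V) : Realization.vertex X u ∈ Realization.openStar X u := by
    simp [Realization.openStar]
  have huniv := hclopen.eq_univ ⟨Realization.vertex X v, mem_U.2 ⟨v, hP, hvertex v⟩⟩
  obtain ⟨u, hu, hwu⟩ := mem_U.1 (huniv ▸ Set.mem_univ (Realization.vertex X w))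
  rwa [← not_not.1 fun hne => hwu.ne' (Realization.vertex_apply_of_ne hne)]

open DoubleCover in
theorem IsSignCocycle.exists_potential [SimplyConnectedSpace X.Realization] {σ : V → V → ℤˣ}
    (hσ : X.IsSignCocycle σ) :
    ∃ F : V → ℤˣ, ∀ C ∈ X.cubes, ∀ v ∈ C, ∀ w ∈ C, F w = F v * σ v w := by
  obtain ⟨p₀⟩ : Nonempty X.Realization := inferInstance
  obtain ⟨v₀, -⟩ := p₀.exists_mem_openStar
  have hreach : ∀ v, ∃ ε, Joined (vertexLift hσ v₀ 1) (vertexLift hσ v ε) :=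
    vertex_induction (P := fun v => ∃ ε, Joined (vertexLift hσ v₀ 1) (vertexLift hσ v ε))
      (fun e ⟨ε, hε⟩ => ⟨_, hε.trans
        (joined_vertexLift hσ e.adj.2 (Set.mem_insert _ _) (Set.mem_insert_of_mem _ rfl) ε)⟩)
      ⟨1, Joined.refl _⟩
  choose F hF using hreach
  refine ⟨F, fun C hC v hv w hw => vertexLift_injective hσ w ?_⟩
  exact eq_of_joined_of_isCoveringMap (isCoveringMap_proj hσ)
    ((hF w).symm.trans ((hF v).trans (joined_vertexLift hσ hC hv hw (F v)))) rfl

/-! ### Potentials of edge signs -/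

/-- `c` assigns signs to the unoriented edges of `X` such that opposite edges of squares have the
same sign. -/
structure IsEdgeSign (c : X.OEdge → ℤˣ) : Prop where
  symm : ∀ e, c e.symm = c e
  square : ∀ e f, X.IsSquare e.fst e.snd f.snd f.fst → c e = c f

/-- The sign `F` of the vertices in `C` changes precisely along the edges in `C` of sign `-1`. -/
def IsPotentialOn (c : X.OEdge → ℤˣ) (C : Set V) (F : V → ℤˣ) : Prop :=
  ∀ e : X.OEdge, e.fst ∈ C → e.snd ∈ C → F e.snd = F e.fst * c e

theorem IsPotentialOn.mono {c : X.OEdge → ℤˣ} {C D : Set V} {F : V → ℤˣ}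
    (hF : IsPotentialOn c D F) (hCD : C ⊆ D) : IsPotentialOn c C F :=
  fun e hfst hsnd => hF e (hCD hfst) (hCD hsnd)

theorem IsPotentialOn.mul_eq_mul {c : X.OEdge → ℤˣ} {C : Set V} {F G : V → ℤˣ}
    (hF : IsPotentialOn c C F) (hG : IsPotentialOn c C G) (hC : C ∈ X.cubes) {v w : V}
    (hv : v ∈ C) (hw : w ∈ C) : F v * F w = G v * G w := by
  refine cube_induction hC (P := fun u => F v * F u = G v * G u) (fun e hfst hsnd he => ?_) hv hw ?_
  · rw [hF e hfst hsnd, hG e hfst hsnd, ← mul_assoc, he, mul_assoc]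
  · rw [Int.units_mul_self, Int.units_mul_self]

namespace IsEdgeSign

variable {c : X.OEdge → ℤˣ}

theorem apply_chart_edge (hc : IsEdgeSign c) {C : Set V} {n : ℕ} {φ : (Fin n → Bool) → V}
    (hφ : IsCubeChart X.cubes C φ) (i : Fin n) (b d : Fin n → Bool) :
    c (hφ.edge b i) = c (hφ.edge d i) := by
  refine flipAt_induction (P := fun d => c (hφ.edge b i) = c (hφ.edge d i))
    (fun d j hd => hd.trans ?_) rfl d
  by_cases hij : i = j
  · rw [← hij, hφ.edge_flipAt_self, hc.symm]
  · exact hc.square _ _ (hφ.isSquare_edge d hij)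

theorem exists_isPotentialOn (hc : IsEdgeSign c) {C : Set V} (hC : C ∈ X.cubes) :
    ∃ F, IsPotentialOn c C F := by
  obtain ⟨n, φ, hφ⟩ := X.exists_chart C hC
  let η (i : Fin n) : ℤˣ := c (hφ.edge (fun _ => false) i)
  let F : V → ℤˣ := Function.extend φ (fun b => ∏ i, if b i then η i else 1) 1
  have F_apply (b : Fin n → Bool) : F (φ b) = ∏ i, if b i then η i else 1 :=
    hφ.injective.extend_apply _ _ b
  refine ⟨F, fun f hfst hsnd => ?_⟩
  obtain ⟨b, i, rfl⟩ := hφ.exists_eq_edge hfst hsnd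
  rw [hc.apply_chart_edge hφ i b fun _ => false]
  calc F (φ (flipAt i b))
    _ = ∏ k, ((if b k then η k else 1) * if k = i then η i else 1) := by
      rw [F_apply]
      refine Finset.prod_congr rfl fun k _ => ?_
      by_cases hk : k = i
      · subst hk
        cases hb : b k <;> simp [hb]
      · simp [flipAt_of_ne hk, hk]
    _ = F (φ b) * η i := by
      rw [Finset.prod_mul_distrib, F_apply, Finset.prod_ite_eq' Finset.univ i fun _ => η i,
        if_pos (Finset.mem_univ i)]

theorem exists_isSignCocycle (hc : IsEdgeSign c) :
    ∃ σ, X.IsSignCocycle σ ∧ ∀ e : X.OEdge, σ e.fst e.snd = c e := by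
  classical
  choose! F hF using fun C (hC : C ∈ X.cubes) => hc.exists_isPotentialOn hC
  let σ (v w : V) : ℤˣ :=
    if h : ∃ C ∈ X.cubes, v ∈ C ∧ w ∈ C then F h.choose v * F h.choose w else 1
  have σ_eq {C : Set V} (hC : C ∈ X.cubes) {v w : V} (hv : v ∈ C) (hw : w ∈ C) :
      σ v w = F C v * F C w := by
    have h : ∃ C ∈ X.cubes, v ∈ C ∧ w ∈ C := ⟨C, hC, hv, hw⟩
    obtain ⟨hD, hvD, hwD⟩ := h.choose_spec
    rw [show σ v w = _ from dif_pos h]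
    exact ((hF _ hD).mono Set.inter_subset_right).mul_eq_mul
      ((hF C hC).mono Set.inter_subset_left) (X.inter_mem C hC _ hD ⟨v, hv, hvD⟩)
      ⟨hv, hvD⟩ ⟨hw, hwD⟩
  refine ⟨σ, fun C hC u hu v hv w hw => ?_, fun e => ?_⟩
  · rw [σ_eq hC hu hv, σ_eq hC hv hw, σ_eq hC hu hw, mul_assoc, ← mul_assoc (F C v),
      Int.units_mul_self, one_mul]
  · have hfst : e.fst ∈ ({e.fst, e.snd} : Set V) := Set.mem_insert _ _
    have hsnd : e.snd ∈ ({e.fst, e.snd} : Set V) := Set.mem_insert_of_mem _ rfl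
    rw [σ_eq e.adj.2 hfst hsnd, hF _ e.adj.2 e hfst hsnd, ← mul_assoc, Int.units_mul_self, one_mul]

theorem exists_potential [SimplyConnectedSpace X.Realization] (hc : IsEdgeSign c) :
    ∃ F : V → ℤˣ, ∀ e : X.OEdge, F e.snd = F e.fst * c e := by
  obtain ⟨σ, hσ, hσc⟩ := hc.exists_isSignCocycle
  obtain ⟨F, hF⟩ := hσ.exists_potential
  exact ⟨F, fun e => by
    rw [← hσc e, hF _ e.adj.2 _ (Set.mem_insert _ _) _ (Set.mem_insert_of_mem _ rfl)]⟩

end IsEdgeSign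

/-! ### Squares, parallelism and labels -/

namespace IsSquare

variable {a b c d : V}

theorem reflect (h : X.IsSquare a b c d) : X.IsSquare a d c b := by
  obtain ⟨hab, hbc, hcd, hda, hac, hbd, hmem⟩ := h
  refine ⟨hda.symm, hcd.symm, hbc.symm, hab.symm, hac, hbd.symm, ?_⟩
  rwa [Set.insert_comm d, Set.pair_comm d, Set.insert_comm c]

theorem rotate (h : X.IsSquare a b c d) : X.IsSquare b c d a := by
  obtain ⟨hab, hbc, hcd, hda, hac, hbd, hmem⟩ := h
  refine ⟨hbc, hcd, hda, hab, hbd, hac.symm, ?_⟩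
  rwa [Set.pair_comm d, Set.insert_comm c, Set.insert_comm b]

theorem flip (h : X.IsSquare a b c d) : X.IsSquare b a d c := h.rotate.reflect

theorem map (h : X.IsSquare a b c d) (g : X.Aut) : X.IsSquare (g • a) (g • b) (g • c) (g • d) := by
  have hadj {v w : V} (hvw : X.skeleton.Adj v w) : X.skeleton.Adj (g • v) (g • w) :=
    (g.mapEdge ⟨(v, w), hvw⟩).adj
  obtain ⟨hab, hbc, hcd, hda, hac, hbd, hmem⟩ := h
  refine ⟨hadj hab, hadj hbc, hadj hcd, hadj hda, (MulAction.injective g).ne hac,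
    (MulAction.injective g).ne hbd, ?_⟩
  simpa only [Set.image_insert_eq, Set.image_singleton] using (g.image_mem_iff _).2 hmem

end IsSquare

theorem parallel_of_isSquare {e f : X.OEdge} (h : X.IsSquare e.fst e.snd f.snd f.fst) :
    Parallel e f :=
  Relation.EqvGen.rel e f h

theorem Parallel.symm_symm {e f : X.OEdge} (h : Parallel e f) : Parallel e.symm f.symm := by
  induction h with
  | rel e f h => exact parallel_of_isSquare h.flip
  | refl e => exact .refl _
  | symm e f _ ih => exact .symm _ _ ih
  | trans e f k _ _ ih₁ ih₂ => exact .trans _ _ _ ih₁ ih₂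

theorem sameHyperplane_refl (e : X.OEdge) : SameHyperplane e e :=
  .inl (.refl e)

theorem sameHyperplane_symm_right {e f : X.OEdge} :
    SameHyperplane e f.symm ↔ SameHyperplane e f := by
  rw [SameHyperplane, SameHyperplane, SimpleGraph.Dart.symm_symm, or_comm]

theorem SameHyperplane.symm_left {e f : X.OEdge} (h : SameHyperplane e f) :
    SameHyperplane e.symm f :=
  h.elim (fun h => .inr h.symm_symm) fun h => .inl (f.symm_symm ▸ h.symm_symm)

theorem sameHyperplane_symm_left {e f : X.OEdge} :
    SameHyperplane e.symm f ↔ SameHyperplane e f :=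
  ⟨fun h => e.symm_symm ▸ h.symm_left, SameHyperplane.symm_left⟩

theorem SameHyperplane.of_isSquare {e f k : X.OEdge} (h : SameHyperplane e f)
    (hfk : X.IsSquare f.fst f.snd k.snd k.fst) : SameHyperplane e k :=
  h.imp (.trans _ _ _ · (parallel_of_isSquare hfk))
    (.trans _ _ _ · (parallel_of_isSquare hfk).symm_symm)

variable {S : Type*}

/-- Some square of `X` has edges with labels `s` and `t` emanating from one of its vertices. For
an admissible labeling this says that `s` and `t` commute, without mentioning hyperplanes. -/
def SquareLabels (ℓ : X.OEdge → S) (s t : S) : Prop :=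
  ∃ e f : X.OEdge, e.fst = f.fst ∧ (∃ w, X.IsSquare e.fst e.snd w f.snd) ∧ ℓ e = s ∧ ℓ f = t

theorem SquareLabels.symm {ℓ : X.OEdge → S} {s t : S} (h : SquareLabels ℓ s t) :
    SquareLabels ℓ t s := by
  obtain ⟨e, f, hef, ⟨w, hw⟩, rfl, rfl⟩ := h
  exact ⟨f, e, hef.symm, ⟨w, hef ▸ hw.reflect⟩, rfl, rfl⟩

namespace IsAdmissible

variable [InvolutiveInv S] {ℓ : X.OEdge → S}

theorem label_eq_of_isSquare (hadm : IsAdmissible ℓ) {e f : X.OEdge}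
    (h : X.IsSquare e.fst e.snd f.snd f.fst) : ℓ e = ℓ f :=
  hadm.parallel _ _ (parallel_of_isSquare h)

theorem label_eq_or_eq_inv (hadm : IsAdmissible ℓ) {e f : X.OEdge} (h : SameHyperplane e f) :
    ℓ e = ℓ f ∨ ℓ e = (ℓ f)⁻¹ :=
  h.imp (hadm.parallel e f) fun h => (hadm.parallel _ _ h).trans (hadm.symm f)

theorem squareLabels_inv_left (hadm : IsAdmissible ℓ) {s t : S} (h : SquareLabels ℓ s t) :
    SquareLabels ℓ s⁻¹ t := by
  obtain ⟨e, f, hef, ⟨w, hw⟩, rfl, rfl⟩ := h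
  let f' : X.OEdge := ⟨(e.snd, w), hw.2.1⟩
  have hff' : ℓ f = ℓ f' := hadm.label_eq_of_isSquare (hef ▸ hw.reflect)
  exact ⟨e.symm, f', rfl, ⟨f.snd, hw.flip⟩, hadm.symm e, hff'.symm⟩

theorem squareLabels_congr_left (hadm : IsAdmissible ℓ) {e e' : X.OEdge} {t : S}
    (h : SameHyperplane e e') : SquareLabels ℓ (ℓ e) t ↔ SquareLabels ℓ (ℓ e') t := by
  rcases hadm.label_eq_or_eq_inv h with h | h
  · rw [h]
  · refine ⟨fun hsq => ?_, fun hsq => h ▸ hadm.squareLabels_inv_left hsq⟩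
    rw [← inv_inv (ℓ e'), ← h]
    exact hadm.squareLabels_inv_left hsq

theorem not_squareLabels_self (hadm : IsAdmissible ℓ) (s : S) : ¬ SquareLabels ℓ s s := by
  rintro ⟨e, f, hef, ⟨w, hw⟩, he, hf⟩
  obtain rfl := hadm.injective e f hef (he.trans hf.symm)
  exact hw.2.2.2.2.2.1 rfl

theorem squareLabels_of_transverse (hadm : IsAdmissible ℓ) {e f : X.OEdge}
    (h : Transverse e f) : SquareLabels ℓ (ℓ e) (ℓ f) := by
  obtain ⟨-, e', f', hef', hsq, he, hf⟩ := h
  have hlabels : SquareLabels ℓ (ℓ e') (ℓ f') := ⟨e', f', hef', hsq, rfl, rfl⟩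
  have hlabels' : SquareLabels ℓ (ℓ e) (ℓ f') := (hadm.squareLabels_congr_left he).2 hlabels
  exact ((hadm.squareLabels_congr_left hf).2 hlabels'.symm).symm

theorem not_sameHyperplane_of_squareLabels (hadm : IsAdmissible ℓ) {e f : X.OEdge}
    (h : SquareLabels ℓ (ℓ e) (ℓ f)) : ¬ SameHyperplane e f := fun hef =>
  hadm.not_squareLabels_self _ ((hadm.squareLabels_congr_left hef).1 h)

theorem spanSquare_of_isSquare (hadm : IsAdmissible ℓ) {e f : X.OEdge} (hef : e.fst = f.fst)
    {w : V} (hw : X.IsSquare e.fst e.snd w f.snd) : SpanSquare e f := by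
  refine ⟨⟨e.fst, ⟨Sym2.mem_mk_left _ _, hef ▸ Sym2.mem_mk_left _ _⟩, ?_⟩,
    hadm.not_sameHyperplane_of_squareLabels ⟨e, f, hef, ⟨w, hw⟩, rfl, rfl⟩,
    e, f, hef, ⟨w, hw⟩, sameHyperplane_refl e, sameHyperplane_refl f⟩
  rintro v ⟨hve, hvf⟩
  rcases Sym2.mem_iff.1 hve with rfl | rfl
  · rfl
  · exact (Sym2.mem_iff.1 hvf).elim (·.trans hef.symm) fun h => absurd h hw.2.2.2.2.2.1

theorem labelsCommute_iff_squareLabels (hadm : IsAdmissible ℓ) {s t : S} :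
    LabelsCommute ℓ s t ↔ SquareLabels ℓ s t := by
  constructor
  · rintro ⟨e, f, -, hspan, rfl, rfl⟩
    exact hadm.squareLabels_of_transverse hspan.2
  · rintro ⟨e, f, hef, ⟨w, hw⟩, he, hf⟩
    exact ⟨e, f, hef, hadm.spanSquare_of_isSquare hef hw, he, hf⟩

theorem smul_eq_of_isSquare (hadm : IsAdmissible ℓ) {g : X.Aut} {a b c d : V}
    (h : X.IsSquare a b c d) (ha : g • a = a) (hb : g • b = b) (hd : g • d = d) : g • c = c := by
  have hmap := h.map g
  rw [ha, hb, hd] at hmap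
  let bc : X.OEdge := ⟨(b, c), h.2.1⟩
  let bgc : X.OEdge := ⟨(b, g • c), hmap.2.1⟩
  let ad : X.OEdge := ⟨(a, d), h.2.2.2.1.symm⟩
  have hbc : ℓ ad = ℓ bc := hadm.label_eq_of_isSquare h.reflect
  have hbgc : ℓ ad = ℓ bgc := hadm.label_eq_of_isSquare hmap.reflect
  exact congrArg (·.snd) (hadm.injective bgc bc rfl (hbgc.symm.trans hbc))

end IsAdmissible

/-- `ℓ` looks the same at all vertices: every vertex is the initial vertex of an edge with any
label that occurs, and two edges with a common initial vertex are edges of a square as soon as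
their labels occur at a corner of some square. -/
structure IsHomogeneous (ℓ : X.OEdge → S) : Prop where
  exists_edge : ∀ (e : X.OEdge) (v : V), ∃ f : X.OEdge, f.fst = v ∧ ℓ f = ℓ e
  exists_square : ∀ e f : X.OEdge, e.fst = f.fst → SquareLabels ℓ (ℓ e) (ℓ f) →
    ∃ w, X.IsSquare e.fst e.snd w f.snd

variable {ℓ : X.OEdge → S}

theorem IsHomogeneous.squareLabels_mapEdge (hhom : IsHomogeneous ℓ) {g : X.Aut} {k f : X.OEdge}
    (hkf : k.fst = f.fst) (hfst : g • k.fst = k.fst) (hsnd : g • k.snd = k.snd)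
    (h : SquareLabels ℓ (ℓ k) (ℓ f)) : SquareLabels ℓ (ℓ k) (ℓ (g.mapEdge f)) := by
  obtain ⟨w, hw⟩ := hhom.exists_square k f hkf h
  have hgk : g.mapEdge k = k := OEdge.ext hfst hsnd
  exact ⟨g.mapEdge k, g.mapEdge f, congrArg (g • ·) hkf, ⟨g • w, hw.map g⟩, congrArg ℓ hgk, rfl⟩

variable [InvolutiveInv S]

theorem IsAdmissible.isHomogeneous (hadm : IsAdmissible ℓ) {Γ : Type*} [Group Γ] (ρ : Γ →* X.Aut)
    (hℓ : ∀ (γ : Γ) (e : X.OEdge), ℓ ((ρ γ).mapEdge e) = ℓ e)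
    (htrans : ∀ v w : V, ∃ γ : Γ, ρ γ • v = w) : IsHomogeneous ℓ where
  exists_edge e v := by
    obtain ⟨γ, hγ⟩ := htrans e.fst v
    exact ⟨(ρ γ).mapEdge e, hγ, hℓ γ e⟩
  exists_square := by
    rintro e f hef ⟨e', f', hef', ⟨w, hw⟩, he, hf⟩
    obtain ⟨γ, hγ⟩ := htrans e'.fst e.fst
    have hγf : ρ γ • f'.fst = f.fst := by rw [← hef', hγ, hef]
    rw [← hadm.injective ((ρ γ).mapEdge e') e hγ ((hℓ γ e').trans he),
      ← hadm.injective ((ρ γ).mapEdge f') f hγf ((hℓ γ f').trans hf)]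
    exact ⟨_, hw.map (ρ γ)⟩

theorem IsHomogeneous.exists_isSquare (hhom : IsHomogeneous ℓ) (hadm : IsAdmissible ℓ)
    {f k : X.OEdge} (hk : k.fst = f.snd) (h : SquareLabels ℓ (ℓ f) (ℓ k)) :
    ∃ k' : X.OEdge, k'.fst = f.fst ∧ ℓ k' = ℓ k ∧ X.IsSquare f.fst f.snd k.snd k'.snd := by
  obtain ⟨w, hw⟩ := hhom.exists_square f.symm k hk.symm (hadm.symm f ▸ hadm.squareLabels_inv_left h)
  let k' : X.OEdge := ⟨(f.fst, w), hw.2.1⟩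
  exact ⟨k', rfl, hadm.label_eq_of_isSquare (f := k) (hk ▸ hw.flip.reflect), hw.flip⟩

/-! ### Automorphisms that fix the carrier of a hyperplane -/

/-- Any two labels that commute with `s` are equal, inverse to each other, or commute. -/
def HasCommutingCentralizer (ℓ : X.OEdge → S) (s : S) : Prop :=
  ∀ t r : S, t ≠ r → SquareLabels ℓ s t → SquareLabels ℓ s r → t = r⁻¹ ∨ SquareLabels ℓ t r

/-- `g` fixes `w` and its neighbours in the carrier of the hyperplane crossed by the edge with
initial vertex `w` and label `s`. -/
def FixesCarrierAt (ℓ : X.OEdge → S) (s : S) (g : X.Aut) (w : V) : Prop :=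
  g • w = w ∧ ∀ f : X.OEdge, f.fst = w → (ℓ f = s ∨ SquareLabels ℓ s (ℓ f)) → g • f.snd = f.snd

namespace FixesCarrierAt

variable {s : S} {g : X.Aut} {f k : X.OEdge}

theorem smul_snd_eq_of_squareLabels (hg : FixesCarrierAt ℓ s g f.fst) (hadm : IsAdmissible ℓ)
    (hhom : IsHomogeneous ℓ) (hf : SquareLabels ℓ s (ℓ f)) (hkf : k.fst = f.snd)
    (hk : ℓ k = s ∨ SquareLabels ℓ s (ℓ k)) (hfk : SquareLabels ℓ (ℓ f) (ℓ k)) :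
    g • k.snd = k.snd := by
  obtain ⟨k', hk', hlabel, hsq⟩ := hhom.exists_isSquare hadm hkf hfk
  exact hadm.smul_eq_of_isSquare hsq hg.1 (hg.2 f rfl (.inr hf)) (hg.2 k' hk' (hlabel ▸ hk))

theorem smul_snd_eq_of_label_ne (hg : FixesCarrierAt ℓ s g f.fst) (hadm : IsAdmissible ℓ)
    (hhom : IsHomogeneous ℓ) (hs : HasCommutingCentralizer ℓ s) (hf : SquareLabels ℓ s (ℓ f))
    (hkf : k.fst = f.snd) (hk : SquareLabels ℓ s (ℓ k)) (hne : ℓ k ≠ ℓ f) :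
    g • k.snd = k.snd := by
  rcases hs _ _ hne.symm hf hk with hinv | hcomm
  · obtain rfl : k = f.symm := hadm.injective _ _ hkf (by rw [hadm.symm, hinv, inv_inv])
    exact hg.1
  · exact hg.smul_snd_eq_of_squareLabels hadm hhom hf hkf (.inr hk) hcomm

/-- The edge with label `ℓ f` at `f.snd` is the only one that the condition on `s` does not
control; it is fixed because `g` permutes the edges at `f.snd` whose label commutes with `s`. -/
theorem snd (hg : FixesCarrierAt ℓ s g f.fst) (hadm : IsAdmissible ℓ) (hhom : IsHomogeneous ℓ)
    (hs : HasCommutingCentralizer ℓ s) (hf : SquareLabels ℓ s (ℓ f)) :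
    FixesCarrierAt ℓ s g f.snd := by
  have hfsnd : g • f.snd = f.snd := hg.2 f rfl (.inr hf)
  have hcross (k : X.OEdge) (hkf : k.fst = f.snd) (hk : ℓ k = s) : g • k.snd = k.snd :=
    hg.smul_snd_eq_of_squareLabels hadm hhom hf hkf (.inl hk) (hk ▸ hf.symm)
  refine ⟨hfsnd, fun k hkf hk => ?_⟩
  rcases hk with hk | hk
  · exact hcross k hkf hk
  by_cases hkl : ℓ k = ℓ f
  swap
  · exact hg.smul_snd_eq_of_label_ne hadm hhom hs hf hkf hk hkl
  obtain ⟨e₀, -, -, -, he₀, -⟩ := id hf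
  obtain ⟨e, hef, he⟩ := hhom.exists_edge e₀ f.snd
  obtain rfl : ℓ e = s := he.trans he₀
  have hgkf : (g.mapEdge k).fst = f.snd := (congrArg (g • ·) hkf).trans hfsnd
  by_cases hgkl : ℓ (g.mapEdge k) = ℓ f
  · exact congrArg (·.snd) (hadm.injective _ k (hgkf.trans hkf.symm) (hgkl.trans hkl.symm))
  · have hgk : SquareLabels ℓ (ℓ e) (ℓ (g.mapEdge k)) :=
      hhom.squareLabels_mapEdge (hef.trans hkf.symm) (by rw [hef, hfsnd]) (hcross e hef rfl) hk
    exact MulAction.injective g (hg.smul_snd_eq_of_label_ne hadm hhom hs hf hgkf hgk hgkl)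

theorem of_isSquare {e f : X.OEdge} (hg : FixesCarrierAt ℓ (ℓ e) g e.fst) (hadm : IsAdmissible ℓ)
    (hhom : IsHomogeneous ℓ) (hs : HasCommutingCentralizer ℓ (ℓ e))
    (h : X.IsSquare e.fst e.snd f.snd f.fst) : FixesCarrierAt ℓ (ℓ e) g f.fst :=
  let k : X.OEdge := ⟨(e.fst, f.fst), h.2.2.2.1.symm⟩
  FixesCarrierAt.snd (f := k) hg hadm hhom hs ⟨e, k, rfl, ⟨f.snd, h⟩, rfl, rfl⟩

end FixesCarrierAt

theorem Parallel.fixesCarrierAt_iff {e f : X.OEdge} (hef : Parallel e f) (hadm : IsAdmissible ℓ)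
    (hhom : IsHomogeneous ℓ) (hs : HasCommutingCentralizer ℓ (ℓ e)) {g : X.Aut} :
    FixesCarrierAt ℓ (ℓ e) g e.fst ↔ FixesCarrierAt ℓ (ℓ f) g f.fst := by
  induction hef with
  | rel e f h =>
    have hlabel := hadm.label_eq_of_isSquare h
    refine ⟨fun hg => hlabel ▸ hg.of_isSquare hadm hhom hs h, fun hg => ?_⟩
    exact hlabel ▸ hg.of_isSquare hadm hhom (hlabel ▸ hs) h.reflect.rotate
  | refl e => rfl
  | symm e f h ih => exact (ih (hadm.parallel _ _ h ▸ hs)).symm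
  | trans e f k h _ ih₁ ih₂ => exact (ih₁ hs).trans (ih₂ (hadm.parallel _ _ h ▸ hs))

/-- `g` fixes the endpoints of all edges that cross the same hyperplane as `e`, i.e. all vertices of
the carrier of this hyperplane. -/
def FixesCarrier (g : X.Aut) (e : X.OEdge) : Prop :=
  ∀ f : X.OEdge, SameHyperplane e f → g • f.fst = f.fst ∧ g • f.snd = f.snd

theorem FixesCarrierAt.fixesCarrier {e : X.OEdge} {g : X.Aut}
    (hg : FixesCarrierAt ℓ (ℓ e) g e.fst) (hadm : IsAdmissible ℓ) (hhom : IsHomogeneous ℓ)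
    (hs : HasCommutingCentralizer ℓ (ℓ e)) : FixesCarrier g e := by
  have hparallel {f : X.OEdge} (h : Parallel e f) : g • f.fst = f.fst ∧ g • f.snd = f.snd :=
    have hgf := (h.fixesCarrierAt_iff hadm hhom hs).1 hg
    ⟨hgf.1, hgf.2 f rfl (.inl rfl)⟩
  exact fun f hef => hef.elim hparallel fun h => (hparallel h).symm

/-! ### Cutting automorphisms along hyperplanes -/

theorem Aut.ext {g h : X.Aut} (H : ∀ v : V, g • v = h • v) : g = h :=
  Subtype.ext (Equiv.ext H)

theorem mem_autGroup_of_forall_exists_eqOn {σ : Equiv.Perm V}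
    (hσ : ∀ C ∈ X.cubes, ∃ k : X.Aut, Set.EqOn σ (k • ·) C)
    (hσ_inv : ∀ C ∈ X.cubes, ∃ k : X.Aut, Set.EqOn (⇑σ⁻¹) (k • ·) C) : σ ∈ X.autGroup := by
  have image_mem {τ : Equiv.Perm V} (hτ : ∀ C ∈ X.cubes, ∃ k : X.Aut, Set.EqOn τ (k • ·) C)
      {C : Set V} (hC : C ∈ X.cubes) : τ '' C ∈ X.cubes := by
    obtain ⟨k, hk⟩ := hτ C hC
    rw [hk.image_eq]
    exact (k.image_mem_iff C).2 hC
  refine fun C => ⟨fun h => ?_, image_mem hσ⟩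
  simpa only [Set.image_image, Equiv.Perm.coe_inv, Equiv.symm_apply_apply, Set.image_id']
    using image_mem hσ_inv h

theorem Aut.exists_piecewise (g : X.Aut) {P : V → Prop} (hP : ∀ v, P (g • v) ↔ P v)
    (hcube : ∀ C ∈ X.cubes, (∀ v ∈ C, P v) ∨ (∀ v ∈ C, ¬ P v) ∨ ∀ v ∈ C, g • v = v) :
    ∃ g' : X.Aut, (∀ v, P v → g' • v = g • v) ∧ ∀ v, ¬ P v → g' • v = v := by
  classical
  let σ (k : X.Aut) (hk : ∀ v, P (k • v) ↔ P v) : Equiv.Perm V :=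
    Equiv.Perm.ofSubtype (Equiv.Perm.subtypePerm k.1 hk)
  have σ_of_mem {k : X.Aut} (hk : ∀ v, P (k • v) ↔ P v) {v : V} (hv : P v) : σ k hk v = k • v :=
    Equiv.Perm.ofSubtype_apply_of_mem _ hv
  have σ_of_notMem {k : X.Aut} (hk : ∀ v, P (k • v) ↔ P v) {v : V} (hv : ¬ P v) : σ k hk v = v :=
    Equiv.Perm.ofSubtype_apply_of_not_mem _ hv
  have eqOn {k : X.Aut} (hk : ∀ v, P (k • v) ↔ P v) {C : Set V}
      (hC : (∀ v ∈ C, P v) ∨ (∀ v ∈ C, ¬ P v) ∨ ∀ v ∈ C, k • v = v) :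
      ∃ k' : X.Aut, Set.EqOn (σ k hk) (k' • ·) C := by
    rcases hC with hC | hC | hC
    · exact ⟨k, fun v hv => σ_of_mem hk (hC v hv)⟩
    · exact ⟨1, fun v hv => (σ_of_notMem hk (hC v hv)).trans (one_smul _ v).symm⟩
    · refine ⟨k, fun v hv => ?_⟩
      by_cases hPv : P v
      exacts [σ_of_mem hk hPv, (σ_of_notMem hk hPv).trans (hC v hv).symm]
  have hP_inv (v : V) : P (g⁻¹ • v) ↔ P v := by rw [← hP, smul_inv_smul]
  have hσ : σ g hP ∈ X.autGroup := by
    refine mem_autGroup_of_forall_exists_eqOn (fun C hC => eqOn hP (hcube C hC)) fun C hC => ?_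
    have hinv : (σ g hP)⁻¹ = σ g⁻¹ hP_inv := (map_inv _ _).symm
    rw [hinv]
    exact eqOn hP_inv ((hcube C hC).imp_right (.imp_right fun h v hv =>
      inv_smul_eq_iff.2 (h v hv).symm))
  exact ⟨⟨σ g hP, hσ⟩, fun v => σ_of_mem hP, fun v => σ_of_notMem hP⟩

open Classical in
/-- The sign `-1` on the edges that cross the same hyperplane as `e`, and `1` elsewhere. The two
sides of the hyperplane are the level sets of a potential of this edge sign. -/
noncomputable def hyperplaneSign (e f : X.OEdge) : ℤˣ :=
  if SameHyperplane e f then -1 else 1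

theorem hyperplaneSign_congr {e e' f f' : X.OEdge}
    (h : SameHyperplane e f ↔ SameHyperplane e' f') :
    hyperplaneSign e f = hyperplaneSign e' f' := by
  rw [hyperplaneSign, hyperplaneSign, h]

theorem hyperplaneSign_eq_one {e f : X.OEdge} (h : ¬ SameHyperplane e f) :
    hyperplaneSign e f = 1 :=
  if_neg h

theorem hyperplaneSign_eq_neg_one_iff {e f : X.OEdge} :
    hyperplaneSign e f = -1 ↔ SameHyperplane e f := by
  unfold hyperplaneSign
  split_ifs with h <;> simp [h]

theorem hyperplaneSign_symm_left (e : X.OEdge) : hyperplaneSign e.symm = hyperplaneSign e :=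
  funext fun _ => hyperplaneSign_congr sameHyperplane_symm_left

theorem isEdgeSign_hyperplaneSign (e : X.OEdge) : IsEdgeSign (hyperplaneSign e) where
  symm _ := hyperplaneSign_congr sameHyperplane_symm_right
  square _ _ h :=
    hyperplaneSign_congr ⟨(·.of_isSquare h), (·.of_isSquare h.reflect.rotate)⟩

theorem eq_of_mem_halfspace {e : X.OEdge} {F : V → ℤˣ}
    (hF : ∀ f : X.OEdge, F f.snd = F f.fst * hyperplaneSign e f) {v : V} (hv : v ∈ halfspace e) :
    F v = F e.snd := by
  induction hv with
  | refl => rfl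
  | tail _ hstep ih =>
    obtain ⟨f, rfl, rfl, hf⟩ := hstep
    rw [hF, ih, hyperplaneSign_eq_one hf, mul_one]

namespace FixesCarrier

variable {g : X.Aut} {e : X.OEdge}

theorem sameHyperplane_mapEdge_iff (hg : FixesCarrier g e) {f : X.OEdge} :
    SameHyperplane e (g.mapEdge f) ↔ SameHyperplane e f := by
  have mapEdge_eq {f : X.OEdge} (hfst : g • f.fst = f.fst) (hsnd : g • f.snd = f.snd) :
      g.mapEdge f = f := OEdge.ext hfst hsnd
  constructor <;> intro h
  · rwa [mapEdge_eq (MulAction.injective g (hg _ h).1) (MulAction.injective g (hg _ h).2)] at h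
  · rwa [mapEdge_eq (hg f h).1 (hg f h).2]

theorem smul_eq_of_mem_cube (hg : FixesCarrier g e) {C : Set V} (hC : C ∈ X.cubes) {f : X.OEdge}
    (hfst : f.fst ∈ C) (hsnd : f.snd ∈ C) (hf : SameHyperplane e f) {v : V} (hv : v ∈ C) :
    g • v = v := by
  obtain ⟨n, φ, hφ⟩ := X.exists_chart C hC
  obtain ⟨b, i, rfl⟩ := hφ.exists_eq_edge hfst hsnd
  rw [← hφ.range_eq] at hv
  obtain ⟨d, rfl⟩ := hv
  rw [← hyperplaneSign_eq_neg_one_iff, (isEdgeSign_hyperplaneSign e).apply_chart_edge hφ i b d,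
    hyperplaneSign_eq_neg_one_iff] at hf
  exact (hg _ hf).1

variable {F : V → ℤˣ}

theorem apply_smul [PreconnectedSpace X.Realization] (hg : FixesCarrier g e)
    (hF : ∀ f : X.OEdge, F f.snd = F f.fst * hyperplaneSign e f) (v : V) : F (g • v) = F v := by
  refine vertex_induction (X := X) (P := fun v => F (g • v) = F v) (fun f hf => ?_)
    (congrArg F (hg e (sameHyperplane_refl e)).1) v
  calc F (g • f.snd)
    _ = F (g • f.fst) * hyperplaneSign e (g.mapEdge f) := hF (g.mapEdge f)
    _ = F f.fst * hyperplaneSign e f := by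
      rw [hf, hyperplaneSign_congr hg.sameHyperplane_mapEdge_iff]
    _ = F f.snd := (hF f).symm

theorem forall_eq_or_forall_ne_or_forall_smul_eq (hg : FixesCarrier g e)
    (hF : ∀ f : X.OEdge, F f.snd = F f.fst * hyperplaneSign e f) {C : Set V} (hC : C ∈ X.cubes)
    (ε : ℤˣ) : (∀ v ∈ C, F v = ε) ∨ (∀ v ∈ C, F v ≠ ε) ∨ ∀ v ∈ C, g • v = v := by
  by_cases hcross : ∃ f : X.OEdge, f.fst ∈ C ∧ f.snd ∈ C ∧ SameHyperplane e f
  · obtain ⟨f, hfst, hsnd, hf⟩ := hcross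
    exact .inr (.inr fun v => hg.smul_eq_of_mem_cube hC hfst hsnd hf)
  have hconst {v w : V} (hv : v ∈ C) (hw : w ∈ C) (hFv : F v = ε) : F w = ε := by
    refine cube_induction hC (P := (F · = ε)) (fun f hfst hsnd hFf => ?_) hv hw hFv
    rw [hF, hyperplaneSign_eq_one fun hf => hcross ⟨f, hfst, hsnd, hf⟩, mul_one, hFf]
  by_cases hε : ∃ v ∈ C, F v = ε
  · obtain ⟨v, hv, hFv⟩ := hε
    exact .inl fun w hw => hconst hv hw hFv
  · exact .inr (.inl fun v hv hFv => hε ⟨v, hv, hFv⟩)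

theorem mem_autPlus [SimplyConnectedSpace X.Realization] (hg : FixesCarrier g e) :
    g ∈ X.AutPlus := by
  obtain ⟨F, hF⟩ := (isEdgeSign_hyperplaneSign e).exists_potential
  have hfst_ne : F e.fst ≠ F e.snd := by
    rw [hF, hyperplaneSign_eq_neg_one_iff.2 (sameHyperplane_refl e), mul_neg_one]
    exact units_ne_neg_self _
  have hcube (C : Set V) (hC : C ∈ X.cubes) :=
    hg.forall_eq_or_forall_ne_or_forall_smul_eq hF hC (F e.snd)
  obtain ⟨g₁, hg₁, hg₁_fix⟩ := g.exists_piecewise (P := (F · = F e.snd))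
    (fun v => by rw [hg.apply_smul hF]) hcube
  obtain ⟨g₂, hg₂, hg₂_fix⟩ := g.exists_piecewise (P := (F · ≠ F e.snd))
    (fun v => by rw [hg.apply_smul hF]) fun C hC => by
      simpa only [not_not] using or_left_comm.1 (hcube C hC)
  have hprod : g = g₁ * g₂ := by
    refine Aut.ext fun v => ?_
    rw [mul_smul]
    by_cases hv : F v = F e.snd
    · rw [hg₂_fix v (not_not.2 hv), hg₁ v hv]
    · rw [hg₂ v hv, hg₁_fix _ (by rwa [hg.apply_smul hF])]
  rw [hprod]
  refine mul_mem (Subgroup.subset_closure ⟨_, ⟨e.symm, rfl⟩, fun v hv => hg₁_fix v ?_⟩)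
    (Subgroup.subset_closure ⟨_, ⟨e, rfl⟩, fun v hv => hg₂_fix v ?_⟩)
  · rw [← hyperplaneSign_symm_left e] at hF
    exact (eq_of_mem_halfspace hF hv).trans_ne hfst_ne
  · exact not_not.2 (eq_of_mem_halfspace hF hv)

end FixesCarrier

/-! ### The topology of the automorphism group -/

open Filter Topology

theorem finite_of_mem_cubes {C : Set V} (hC : C ∈ X.cubes) : C.Finite := by
  obtain ⟨n, φ, hφ⟩ := X.exists_chart C hC
  exact hφ.range_eq ▸ Set.finite_range φ

theorem LocallyFinite.finite_star (hfin : X.LocallyFinite) (v : V) :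
    (⋃ C ∈ {C | C ∈ X.cubes ∧ v ∈ C}, C).Finite :=
  (hfin v).biUnion fun _ hC => finite_of_mem_cubes hC.1

theorem LocallyFinite.finite_neighborSet (hfin : X.LocallyFinite) (v : V) :
    (X.skeleton.neighborSet v).Finite :=
  (hfin.finite_star v).subset fun w hw =>
    Set.mem_biUnion (x := {v, w}) ⟨hw.2, Set.mem_insert _ _⟩ (Set.mem_insert_of_mem _ rfl)

theorem LocallyFinite.exists_finite_support_subset (hfin : X.LocallyFinite)
    {K : Set X.Realization} (hK : IsCompact K) :
    ∃ F : Set V, F.Finite ∧ ∀ p ∈ K, Function.support p.1 ⊆ F := by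
  obtain ⟨t, ht⟩ := hK.elim_finite_subcover (Realization.openStar X) Realization.isOpen_openStar
    fun p _ => Set.mem_iUnion.2 p.exists_mem_openStar
  refine ⟨⋃ v ∈ t, ⋃ C ∈ {C | C ∈ X.cubes ∧ v ∈ C}, C,
    t.finite_toSet.biUnion fun v _ => hfin.finite_star v, fun p hp w hw => ?_⟩
  obtain ⟨v, hvt, hpv⟩ := Set.mem_iUnion₂.1 (ht hp)
  obtain ⟨C, hC, hsupp⟩ := p.exists_support_subset
  exact Set.mem_biUnion hvt (Set.mem_biUnion (x := C) ⟨hC, hsupp (ne_of_gt hpv)⟩ (hsupp hw))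

namespace Aut

theorem realize_eq_of_eqOn_support {g k : X.Aut} {p : X.Realization}
    (h : ∀ v ∈ Function.support p.1, k • v = g • v) : k.realize p = g.realize p := by
  refine Subtype.ext (funext fun v => ?_)
  change p.1 (k⁻¹ • v) = p.1 (g⁻¹ • v)
  by_cases hk : p.1 (k⁻¹ • v) = 0
  · by_cases hg : p.1 (g⁻¹ • v) = 0
    · rw [hk, hg]
    · rw [inv_smul_eq_iff.2 ((smul_inv_smul g v).symm.trans (h _ hg).symm)]
  · rw [inv_smul_eq_iff.2 ((smul_inv_smul k v).symm.trans (h _ hk))]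

theorem isOpen_setOf_smul_eq (v w : V) : IsOpen {g : X.Aut | g • v = w} := by
  have hpreimage : {g : X.Aut | g • v = w} = realize ⁻¹'
      {F | Set.MapsTo F {Realization.vertex X v} (Realization.openStar X w)} := by
    ext g
    simp only [Set.mem_ofPred_eq, Set.mem_preimage, Set.mapsTo_singleton]
    change _ ↔ 0 < (Realization.vertex X v).1 (g⁻¹ • w)
    rw [eq_comm, ← inv_smul_eq_iff]
    by_cases h : g⁻¹ • w = v
    · simp [h, Realization.vertex_apply_self]
    · simp [h, Realization.vertex_apply_of_ne]
  rw [hpreimage]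
  exact (ContinuousMap.isOpen_setOfPred_mapsTo isCompact_singleton
    (Realization.isOpen_openStar w)).preimage continuous_induced_dom

instance : T2Space X.Aut where
  t2 g h hgh := by
    obtain ⟨v, hv⟩ : ∃ v : V, g • v ≠ h • v := not_forall.1 fun heq => hgh (Aut.ext heq)
    refine ⟨_, _, isOpen_setOf_smul_eq v (g • v), isOpen_setOf_smul_eq v (h • v), rfl, rfl, ?_⟩
    exact Set.disjoint_left.2 fun k hkg hkh => hv (hkg.symm.trans hkh)

theorem le_nhds_of_eventually_smul_eq (hfin : X.LocallyFinite) {l : Filter X.Aut} {g : X.Aut}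
    (h : ∀ v : V, ∀ᶠ k in l, k • v = g • v) : l ≤ 𝓝 g := by
  rw [nhds_induced, ← map_le_iff_le_comap]
  refine ContinuousMap.tendsto_nhds_compactOpen.2 fun K hK U _ hKU => ?_
  obtain ⟨F, hF, hsupp⟩ := hfin.exists_finite_support_subset hK
  filter_upwards [(eventually_all_finite hF).2 fun v _ => h v] with k hk p hp
  rw [realize_eq_of_eqOn_support fun v hv => hk v (hsupp p hp hv)]
  exact hKU hp

theorem exists_eventually_smul_eq [PreconnectedSpace X.Realization] (hfin : X.LocallyFinite)
    {l : Ultrafilter X.Aut} {v w : V} (h : ∀ᶠ g : X.Aut in l, g • v = w) (u : V) :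
    ∃ u', ∀ᶠ g : X.Aut in l, g • u = u' := by
  refine vertex_induction (X := X) (P := fun u => ∃ u', ∀ᶠ g : X.Aut in l, g • u = u')
    (fun e ⟨x, hx⟩ => ?_) ⟨w, h⟩ u
  have hneighbor : ∀ᶠ g : X.Aut in l, g • e.snd ∈ X.skeleton.neighborSet x := by
    filter_upwards [hx] with g hg
    exact hg ▸ (g.mapEdge e).adj
  obtain ⟨y, -, hy⟩ := Ultrafilter.eq_pure_of_finite_mem (f := l.map (· • e.snd))
    (hfin.finite_neighborSet x) hneighbor
  have hmem : {y} ∈ l.map (· • e.snd) := hy ▸ rfl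
  exact ⟨y, hmem⟩

theorem exists_forall_eventually_smul_eq {l : Filter X.Aut} [l.NeBot]
    (h : ∀ v : V, ∃ w, ∀ᶠ g in l, g • v = w) (h_inv : ∀ v : V, ∃ w, ∀ᶠ g in l, g⁻¹ • v = w) :
    ∃ g₀ : X.Aut, ∀ v : V, ∀ᶠ g in l, g • v = g₀ • v := by
  choose φ hφ using h
  choose ψ hψ using h_inv
  let σ : Equiv.Perm V :=
    { toFun := φ
      invFun := ψ
      left_inv := fun v => by
        obtain ⟨g, hgφ, hgψ⟩ := ((hφ v).and (hψ (φ v))).exists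
        rw [← hgψ, ← hgφ, inv_smul_smul]
      right_inv := fun v => by
        obtain ⟨g, hgψ, hgφ⟩ := ((hψ v).and (hφ (ψ v))).exists
        rw [← hgφ, ← hgψ, smul_inv_smul] }
  have hσ : σ ∈ X.autGroup := by
    refine mem_autGroup_of_forall_exists_eqOn (fun C hC => ?_) fun C hC => ?_
    · obtain ⟨g, hg⟩ := ((eventually_all_finite (finite_of_mem_cubes hC)).2 fun v _ => hφ v).exists
      exact ⟨g, fun v hv => (hg v hv).symm⟩
    · obtain ⟨g, hg⟩ := ((eventually_all_finite (finite_of_mem_cubes hC)).2 fun v _ => hψ v).exists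
      exact ⟨g⁻¹, fun v hv => (hg v hv).symm⟩
  exact ⟨⟨σ, hσ⟩, hφ⟩

theorem isCompact_setOf_smul_eq [PreconnectedSpace X.Realization] (hfin : X.LocallyFinite)
    (v w : V) : IsCompact {g : X.Aut | g • v = w} := by
  refine isCompact_iff_ultrafilter_le_nhds.2 fun l hl => ?_
  have hvw : ∀ᶠ g : X.Aut in l, g • v = w := hl (mem_principal_self _)
  have hwv : ∀ᶠ g : X.Aut in l.map (·⁻¹), g • w = v :=
    hvw.mono fun g hg => inv_smul_eq_iff.2 hg.symm
  have h_inv (u : V) : ∃ u', ∀ᶠ g : X.Aut in l, g⁻¹ • u = u' :=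
    exists_eventually_smul_eq hfin hwv u
  obtain ⟨g₀, hg₀⟩ :=
    exists_forall_eventually_smul_eq (exists_eventually_smul_eq hfin hvw) h_inv
  refine ⟨g₀, ?_, le_nhds_of_eventually_smul_eq hfin hg₀⟩
  obtain ⟨g, hg, hgw⟩ := ((hg₀ v).and hvw).exists
  exact hg.symm.trans hgw

theorem locallyCompactSpace [ConnectedSpace X.Realization] (hfin : X.LocallyFinite) :
    LocallyCompactSpace X.Aut := by
  obtain ⟨p⟩ : Nonempty X.Realization := inferInstance
  obtain ⟨v, -⟩ := p.exists_mem_openStar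
  have : WeaklyLocallyCompactSpace X.Aut :=
    ⟨fun g => ⟨{k | k • v = g • v}, isCompact_setOf_smul_eq hfin v _,
      (isOpen_setOf_smul_eq v _).mem_nhds rfl⟩⟩
  infer_instance

theorem isOpen_of_forall_smul_eq_mem {H : Subgroup X.Aut} {K : Set V} (hK : K.Finite)
    (hH : ∀ g : X.Aut, (∀ v ∈ K, g • v = v) → g ∈ H) : IsOpen (H : Set X.Aut) := by
  refine isOpen_iff_mem_nhds.2 fun g hg => ?_
  have hnhds : ∀ᶠ k in 𝓝 g, ∀ v ∈ K, k • v = g • v :=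
    (eventually_all_finite hK).2 fun v _ => (isOpen_setOf_smul_eq v (g • v)).mem_nhds rfl
  filter_upwards [hnhds] with k hk
  have hfix : g⁻¹ * k ∈ H := hH _ fun v hv => by rw [mul_smul, hk v hv, inv_smul_smul]
  exact (H.mul_mem_cancel_left (H.inv_mem hg)).1 hfix

end Aut

end CubeComplex

theorem mainTheorem8_general {V : Type*} (X : CubeComplex V) [SimplyConnectedSpace X.Realization]
    (hfin : X.LocallyFinite) {S : Type*} [InvolutiveInv S] (ℓ : X.OEdge → S)
    (hadm : CubeComplex.IsAdmissible ℓ) (hhom : CubeComplex.IsHomogeneous ℓ)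
    (hs : ∃ s : S, (∃ e : X.OEdge, ℓ e = s) ∧
      ∀ t r : S, t ≠ r → CubeComplex.LabelsCommute ℓ s t → CubeComplex.LabelsCommute ℓ s r →
        t = r⁻¹ ∨ CubeComplex.LabelsCommute ℓ t r) :
    LocallyCompactSpace X.AutPlus ∧
      ∃ K : Set V, K.Finite ∧ ∀ g : X.Aut, (∀ v ∈ K, g • v = v) → g ∈ X.AutPlus := by
  obtain ⟨_, ⟨e, rfl⟩, hs⟩ := hs
  simp only [hadm.labelsCommute_iff_squareLabels] at hs
  let K : Set V := insert e.fst (X.skeleton.neighborSet e.fst)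
  have hKfin : K.Finite := (hfin.finite_neighborSet e.fst).insert e.fst
  have hK (g : X.Aut) (hg : ∀ v ∈ K, g • v = v) : g ∈ X.AutPlus := by
    have hfix : CubeComplex.FixesCarrierAt ℓ (ℓ e) g e.fst :=
      ⟨hg _ (Set.mem_insert _ _), fun f hf _ => hg _ (Set.mem_insert_of_mem _ (hf ▸ f.adj))⟩
    exact (hfix.fixesCarrier hadm hhom hs).mem_autPlus
  have := CubeComplex.Aut.locallyCompactSpace hfin
  exact ⟨(CubeComplex.Aut.isOpen_of_forall_smul_eq_mem hKfin hK).locallyCompactSpace, K, hKfin, hK⟩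

theorem mainTheorem8 {V : Type*} (X : CubeComplex V) (hfin : X.LocallyFinite) (hcat : X.IsCAT0)
    {S : Type*} [Finite S] [InvolutiveInv S] (hinv : ∀ s : S, s⁻¹ ≠ s)
    (ℓ : X.OEdge → S) (hadm : CubeComplex.IsAdmissible ℓ)
    {Γ : Type*} [Group Γ] (ρ : Γ →* X.Aut)
    (hℓ : ∀ (γ : Γ) (e : X.OEdge), ℓ ((ρ γ).mapEdge e) = ℓ e)
    (htrans : ∀ v w : V, ∃ γ : Γ, ρ γ • v = w)
    (hs : ∃ s : S, (∃ e : X.OEdge, ℓ e = s) ∧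
      ∀ t r : S, t ≠ r → CubeComplex.LabelsCommute ℓ s t → CubeComplex.LabelsCommute ℓ s r →
        t = r⁻¹ ∨ CubeComplex.LabelsCommute ℓ t r) :
    LocallyCompactSpace X.AutPlus ∧
      ∃ K : Set V, K.Finite ∧ ∀ g : X.Aut, (∀ v ∈ K, g • v = v) → g ∈ X.AutPlus := by
  have := hcat.simplyConnected
  exact mainTheorem8_general X hfin ℓ hadm (hadm.isHomogeneous ρ hℓ htrans) hs
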